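/- Let $\mathbb{H}$ be a separable real Hilbert space and let $\mathcal{H},\hat{\mathcal{H}}$ be compact self-adjoint operators on $\mathbb{H}$ all of whose eigenvalues are non-negative. Write $$\mathcal{H}=\sum_{k\ge1}\lambda_k\,\psi_k\otimes\psi_k,\qquad \hat{\mathcal{H}}=\sum_{k\ge1}\hat\lambda_k\,\hat\psi_k\otimes\hat\psi_k,$$ where $\lambda_1\ge\lambda_2\ge\dots\ge0$ and $\hat\lambda_1\ge\hat\lambda_2\ge\dots\ge0$ are the eigenvalues repeated according to multiplicity (continued by zeros if there are only finitely many), $\psi_k$ and $\hat\psi_k$ are corresponding orthonormal eigenvectors (only those belonging to nonzero eigenvalues matter), and $(u\otimes v)w=\langle v,w\rangle u$. Let $\mathcal{J}\subset\mathbb{N}$ be a nonempty finite set with $$\min_{k\in\mathcal{J},\,\ell\notin\mathcal{J}}|\lambda_k-\lambda_\ell|>0 .$$ Let $\theta_1>\dots>\theta_K$ be the distinct values of $\{\lambda_k\}_{k\in\mathcal{J}}$, and put $\mathcal{J}_j=\{k\in\mathcal{J}:\lambda_k=\theta_j\}$ and $\gamma_{\mathcal{J}_j}=\min_{\ell\notin\mathcal{J}_j}|\theta_j-\lambda_\ell|$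 for $j=1,\dots,K$. Assume that, with $\|\cdot\|_{\mathrm{op}}$ the operator norm, $$\max_{1\le j\le K}\frac{\|\hat{\mathcal{H}}-\mathcal{H}\|_{\mathrm{op}}}{\gamma_{\mathcal{J}_j}}<\frac14 .$$ Then $$\Big\|(\hat\lambda_k-\lambda_k)_{k\in\mathcal{J}}-\bigoplus_{j=1}^K\mathrm{spec}_{\downarrow}\big(\langle(\hat{\mathcal{H}}-\mathcal{H})\psi_k,\psi_\ell\rangle\big)_{k,\ell\in\mathcal{J}_j}\Big\|_2\le\sqrt{\sum_{j=1}^K\frac{|\mathcal{J}_j|\,(11\gamma_{\mathcal{J}_j}+32\theta_j)^2}{4}\left(\frac{\|\hat{\mathcal{H}}-\mathcal{H}\|_{\mathrm{op}}}{\gamma_{\mathcal{J}_j}}\right)^4}.$$ Here vectors and matrices indexed by a set of natural numbers are listed in increasing order of the index, $\mathrm{spec}_{\downarrow}(A)$ is the vector of eigenvalues of the symmetric matrix $A$, with multiplicity, in non-increasing order, $\bigoplus$ is concatenation of vectors in the order $j=1,\dots,K$, and $\|\cdot\|_2$ is the Euclidean norm. -/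

import Mathlib

noncomputable section

namespace SpectralExpansion

/-- `lam` and `ψ` form an eigen-decomposition
`T = ∑ k, lam k • (ψ k ⊗ ψ k)` with `lam 0 ≥ lam 1 ≥ ⋯ ≥ 0` (repeated according to multiplicity)
and orthonormal eigenvectors.

Orthonormality is only required of the eigenvectors that occur in the sum with a nonzero
coefficient.  Every decomposition with a fully orthonormal sequence `ψ` satisfies this, and so does
an operator on a finite-dimensional space whose list of eigenvalues is continued by zeros. -/
structure IsEigenDecomposition {E : Type*} [NormedAddCommGroup E] [InnerProductSpace ℝ E]
    (T : E →L[ℝ] E) (lam : ℕ → ℝ) (ψ : ℕ → E) : Prop where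
  antitone : Antitone lam
  nonneg : ∀ k, 0 ≤ lam k
  orthonormal : Orthonormal ℝ (fun k : {k : ℕ // lam k ≠ 0} => ψ k)
  hasSum : ∀ x : E, HasSum (fun k => lam k • (inner ℝ (ψ k) x • ψ k)) (T x)

/-- The spectral gap `min {|lam k - lam l| : k ∈ J, l ∉ J}`. -/
def spectralGap (lam : ℕ → ℝ) (J : Finset ℕ) : ℝ :=
  sInf {d : ℝ | ∃ k ∈ J, ∃ l ∉ J, d = |lam k - lam l|}

/-- The number `K` of distinct values among `lam k`, `k ∈ J`. -/
def numDistinct (lam : ℕ → ℝ) (J : Finset ℕ) : ℕ := (J.image lam).card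

/-- The distinct values `θ 0 > θ 1 > ⋯ > θ (K - 1)` of `lam` on `J`, in decreasing order. -/
def theta (lam : ℕ → ℝ) (J : Finset ℕ) (j : Fin (numDistinct lam J)) : ℝ :=
  (J.image lam).orderEmbOfFin rfl (Fin.rev j)

/-- The block `{k ∈ J : lam k = θ j}`. -/
def block (lam : ℕ → ℝ) (J : Finset ℕ) (j : Fin (numDistinct lam J)) : Finset ℕ :=
  J.filter (fun k => lam k = theta lam J j)

/-- The individual spectral gap `min {|θ j - lam l| : l ∉ block j}`. -/
def blockGap (lam : ℕ → ℝ) (J : Finset ℕ) (j : Fin (numDistinct lam J)) : ℝ :=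
  sInf {d : ℝ | ∃ l ∉ block lam J j, d = |theta lam J j - lam l|}

/-- The vector `(a k)` for `k ∈ J`, listed in increasing order of `k`. -/
def indexedVec (a : ℕ → ℝ) (J : Finset ℕ) : Fin J.card → ℝ :=
  fun i => a (J.orderEmbOfFin rfl i)

/-- The matrix `(⟨A ψ_k, ψ_l⟩)` for `k, l ∈ J`, rows and columns in increasing order. -/
def gramMatrix {E : Type*} [NormedAddCommGroup E] [InnerProductSpace ℝ E]
    (A : E →L[ℝ] E) (ψ : ℕ → E) (J : Finset ℕ) : Matrix (Fin J.card) (Fin J.card) ℝ :=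
  Matrix.of fun a b =>
    inner ℝ (A (ψ (J.orderEmbOfFin rfl a))) (ψ (J.orderEmbOfFin rfl b))

theorem gramMatrix_isHermitian {E : Type*} [NormedAddCommGroup E] [InnerProductSpace ℝ E]
    [CompleteSpace E] {A : E →L[ℝ] E} (hA : IsSelfAdjoint A) (ψ : ℕ → E) (J : Finset ℕ) :
    (gramMatrix A ψ J).IsHermitian := by
  ext a b
  simp only [gramMatrix, Matrix.conjTranspose_apply, Matrix.of_apply, star_trivial]
  rw [real_inner_comm]
  exact (hA.isSymmetric _ _).symm

/-- The eigenvalues of a real symmetric matrix with multiplicity, in non-increasing order. -/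
def specDown {m : ℕ} (A : Matrix (Fin m) (Fin m) ℝ) (hA : A.IsHermitian) : Fin m → ℝ :=
  fun i => hA.eigenvalues₀ (Fin.cast (Fintype.card_fin m).symm i)

/-- The direct sum (concatenation, in order) of finitely many vectors. -/
def vecDirectSum {K : ℕ} {n : Fin K → ℕ} (v : (j : Fin K) → Fin (n j) → ℝ) :
    Fin (∑ j, n j) → ℝ :=
  fun i => v (finSigmaFinEquiv.symm i).1 (finSigmaFinEquiv.symm i).2

/-- The blocks partition `J`, so the concatenated vector has `|J|` entries. -/
theorem card_eq_sum_card_block (lam : ℕ → ℝ) (J : Finset ℕ) :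
    J.card = ∑ j, (block lam J j).card := by
  have h1 : J.card = ∑ t ∈ J.image lam, (J.filter (fun k => lam k = t)).card :=
    Finset.card_eq_sum_card_fiberwise fun k hk => Finset.mem_image_of_mem lam hk
  rw [h1, ← Finset.sum_coe_sort]
  exact (Equiv.sum_comp (Fin.revPerm.trans ((J.image lam).orderIsoOfFin rfl).toEquiv)
    (fun t : J.image lam => (J.filter (fun k => lam k = (t : ℝ))).card)).symm

end SpectralExpansion

end

/-!
On a block `B = {k : lam k = θ}` the eigenvalues of `Hhat = H + D` satisfy
`|lamhat k - θ - μ k| ≤ 2 ‖D‖² / γ`, where `μ` lists the eigenvalues of the compression of `D` to the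
eigenspace of `θ` and `γ` is the distance from `θ` to the rest of the spectrum.  Since
`2 ‖D‖² / γ ≤ (11 γ + 32 θ) / 2 * (‖D‖ / γ)²`, squaring and summing over all entries gives the
Euclidean bound.

The entrywise bound is a min-max argument.  Rotating the eigenvectors inside the eigenspace
(`IsEigenDecomposition.rotateBlock`) keeps them an eigen-decomposition of `H` and makes the compressed
perturbation diagonal with decreasing entries.  Then `lamhat k` is bounded below by the minimum of
the form of `Hhat` on the span of the eigenvectors of index at most `k`, and above by its maximum on
the orthogonal complement of those of index less than `k`
(`IsEigenDecomposition.le_of_forall_le_inner`, `IsEigenDecomposition.le_of_forall_inner_le`).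
A test vector splits as `u + v` with `v` in the eigenspace and `u` in the part of the spectrum at
distance `γ` from `θ`.  The form of `D` on `v` contributes `μ`; the cross terms are at most
`2 ‖D‖ ‖u‖ ‖v‖` and are absorbed in the surplus `γ ‖u‖²` by completing the square, leaving an
error `2 ‖D‖² / γ` (`le_inner_add_apply_add`).

Finally, concatenating the blocks by decreasing `θ` lists `J` in increasing order, because `lam` is
decreasing (`orderEmbOfFin_eq_block`).
-/

namespace SpectralExpansion

/-! ### Eigen-decompositions and their quadratic forms -/

section Decomposition

variable {E : Type*} [NormedAddCommGroup E] [InnerProductSpace ℝ E]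
  {T : E →L[ℝ] E} {lam : ℕ → ℝ} {ψ : ℕ → E}

theorem IsEigenDecomposition.inner_eq (h : IsEigenDecomposition T lam ψ) {k l : ℕ}
    (hk : lam k ≠ 0) (hl : lam l ≠ 0) : inner ℝ (ψ k) (ψ l) = if k = l then (1 : ℝ) else 0 := by
  have := orthonormal_iff_ite.1 h.orthonormal ⟨k, hk⟩ ⟨l, hl⟩
  simpa [Subtype.ext_iff] using this

theorem IsEigenDecomposition.apply_eigenvector (h : IsEigenDecomposition T lam ψ) {k : ℕ}
    (hk : lam k ≠ 0) : T (ψ k) = lam k • ψ k := by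
  have h1 := hasSum_single (f := fun l => lam l • ((inner ℝ (ψ l) (ψ k) : ℝ) • ψ l)) k (by
    intro l hl
    by_cases h0 : lam l = 0
    · simp [h0]
    · simp [h.inner_eq h0 hk, hl])
  have h2 := (h.hasSum (ψ k)).unique h1
  rwa [h.inner_eq hk hk, if_pos rfl, one_smul] at h2

theorem IsEigenDecomposition.inner_sum_sum (h : IsEigenDecomposition T lam ψ) {s t : Finset ℕ}
    (hs : ∀ k ∈ s, lam k ≠ 0) (ht : ∀ k ∈ t, lam k ≠ 0) (c d : ℕ → ℝ) :
    inner ℝ (∑ k ∈ s, c k • ψ k) (∑ l ∈ t, d l • ψ l) = ∑ k ∈ s ∩ t, c k * d k := by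
  rw [sum_inner, ← Finset.filter_mem_eq_inter, Finset.sum_filter]
  refine Finset.sum_congr rfl fun k hk => ?_
  rw [inner_sum, Finset.sum_congr rfl fun l hl => by
    rw [real_inner_smul_left, inner_smul_right, h.inner_eq (hs k hk) (ht l hl)]]
  simp

theorem IsEigenDecomposition.inner_eigenvector_sum (h : IsEigenDecomposition T lam ψ)
    {s : Finset ℕ} (hs : ∀ k ∈ s, lam k ≠ 0) (c : ℕ → ℝ) {l : ℕ} (hl : lam l ≠ 0) :
    inner ℝ (ψ l) (∑ k ∈ s, c k • ψ k) = if l ∈ s then c l else 0 := by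
  rw [inner_sum, Finset.sum_congr rfl fun k hk => by
    rw [inner_smul_right, h.inner_eq hl (hs k hk)]]
  simp

theorem IsEigenDecomposition.apply_sum (h : IsEigenDecomposition T lam ψ) {s : Finset ℕ}
    (hs : ∀ k ∈ s, lam k ≠ 0) (c : ℕ → ℝ) :
    T (∑ k ∈ s, c k • ψ k) = ∑ k ∈ s, (lam k * c k) • ψ k := by
  rw [map_sum]
  refine Finset.sum_congr rfl fun k hk => ?_
  rw [map_smul, h.apply_eigenvector (hs k hk), smul_smul, mul_comm]

theorem IsEigenDecomposition.norm_sq_sum (h : IsEigenDecomposition T lam ψ) {s : Finset ℕ}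
    (hs : ∀ k ∈ s, lam k ≠ 0) (c : ℕ → ℝ) :
    ‖∑ k ∈ s, c k • ψ k‖ ^ 2 = ∑ k ∈ s, c k ^ 2 := by
  rw [← real_inner_self_eq_norm_sq, h.inner_sum_sum hs hs, Finset.inter_self]
  simp [sq]

theorem IsEigenDecomposition.le_inner_apply_sum (h : IsEigenDecomposition T lam ψ)
    {s : Finset ℕ} {m : ℝ} (hs : ∀ k ∈ s, lam k ≠ 0) (hm : ∀ k ∈ s, m ≤ lam k) (c : ℕ → ℝ) :
    m * ‖∑ k ∈ s, c k • ψ k‖ ^ 2 ≤ inner ℝ (T (∑ k ∈ s, c k • ψ k)) (∑ k ∈ s, c k • ψ k) := by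
  rw [h.norm_sq_sum hs, h.apply_sum hs, h.inner_sum_sum hs hs, Finset.inter_self, Finset.mul_sum]
  refine Finset.sum_le_sum fun k hk => ?_
  nlinarith [hm k hk, sq_nonneg (c k)]

/-- On vectors orthogonal to the eigenvectors whose eigenvalue exceeds `m ≥ 0`, the quadratic form
is at most `m` times the squared norm.  The eigenvectors need not be complete: on the orthogonal
complement of their span the form vanishes, which is why `m` has to be non-negative. -/
theorem IsEigenDecomposition.inner_apply_le (h : IsEigenDecomposition T lam ψ) {m : ℝ}
    (hm : 0 ≤ m) {x : E} (hx : ∀ k, m < lam k → inner ℝ (ψ k) x = (0 : ℝ)) :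
    inner ℝ (T x) x ≤ m * ‖x‖ ^ 2 := by
  have h1 : HasSum (fun k => lam k * (inner ℝ (ψ k) x : ℝ) ^ 2) (inner ℝ (T x) x) := by
    have := (h.hasSum x).mapL (innerSL ℝ x)
    simp only [innerSL_apply_apply, inner_smul_right] at this
    rw [real_inner_comm]
    convert! this using 2
    rw [real_inner_comm x (ψ _)]; ring
  refine hasSum_le_of_sum_le h1 fun s => ?_
  have h2 := h.orthonormal.sum_inner_products_le (s := s.subtype fun k => lam k ≠ 0) x
  have h3 : ∑ k ∈ s.subtype (fun k => lam k ≠ 0), ‖(inner ℝ (ψ k) x : ℝ)‖ ^ 2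
      = ∑ k ∈ s with lam k ≠ 0, ‖(inner ℝ (ψ k) x : ℝ)‖ ^ 2 := by
    rw [Finset.sum_subtype_eq_sum_filter (s := s) (p := fun k => lam k ≠ 0)
      (fun k => ‖(inner ℝ (ψ k) x : ℝ)‖ ^ 2)]
  rw [h3, Finset.sum_filter] at h2
  refine le_trans ?_ (mul_le_mul_of_nonneg_left h2 hm)
  rw [Finset.mul_sum]
  refine Finset.sum_le_sum fun k _ => ?_
  by_cases h0 : lam k = 0
  · simp [h0]
  · rw [if_pos h0, Real.norm_eq_abs, sq_abs]
    rcases lt_or_ge m (lam k) with hlt | hge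
    · simp [hx k hlt]
    · exact mul_le_mul_of_nonneg_right hge (sq_nonneg _)

end Decomposition

/-! ### Min-max bounds -/

section MinMax

variable {E : Type*} [NormedAddCommGroup E] [InnerProductSpace ℝ E]

/-- A space spanned by `k + 1` vectors meets the orthogonal complement of `k` vectors. -/
theorem exists_combination_orthogonal (f φ : ℕ → E) (k : ℕ) :
    ∃ c : ℕ → ℝ, (∃ l ∈ Finset.range (k + 1), c l ≠ 0) ∧
      ∀ i < k, inner ℝ (φ i) (∑ l ∈ Finset.range (k + 1), c l • f l) = (0 : ℝ) := by
  let F : (Fin (k + 1) → ℝ) →ₗ[ℝ] (Fin k → ℝ) :=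
    LinearMap.pi fun i => (innerₛₗ ℝ (φ i)) ∘ₗ Fintype.linearCombination ℝ
      (fun l : Fin (k + 1) => f l)
  have hF : LinearMap.ker F ≠ ⊥ := F.ker_ne_bot_of_finrank_lt (by simp)
  obtain ⟨c, hc, hc0⟩ := (Submodule.ne_bot_iff _).mp hF
  obtain ⟨a, ha⟩ := Function.ne_iff.1 hc0
  refine ⟨fun l => if h : l < k + 1 then c ⟨l, h⟩ else 0,
    ⟨a, Finset.mem_range.2 a.2, (dif_pos a.2).trans_ne ha⟩, ?_⟩
  intro i hi
  have h1 := congrFun (LinearMap.mem_ker.1 hc) ⟨i, hi⟩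
  rw [Finset.sum_range]
  simpa only [Fin.is_lt, dite_true, F, LinearMap.pi_apply, LinearMap.comp_apply,
    Fintype.linearCombination_apply, innerₛₗ_apply_apply, Pi.zero_apply] using h1

variable {T : E →L[ℝ] E} {lam : ℕ → ℝ} {ψ : ℕ → E}

/-- Lower half of the min-max principle: if the form of `T` is at least `m` on the span of `k + 1`
linearly independent vectors, then `m ≤ lam k`. -/
theorem IsEigenDecomposition.le_of_forall_le_inner (h : IsEigenDecomposition T lam ψ)
    {f : ℕ → E} {k : ℕ} {m : ℝ}
    (hf : ∀ c : ℕ → ℝ, (∃ l ∈ Finset.range (k + 1), c l ≠ 0) →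
      ∑ l ∈ Finset.range (k + 1), c l • f l ≠ 0)
    (hm : ∀ c : ℕ → ℝ, m * ‖∑ l ∈ Finset.range (k + 1), c l • f l‖ ^ 2 ≤
      inner ℝ (T (∑ l ∈ Finset.range (k + 1), c l • f l))
        (∑ l ∈ Finset.range (k + 1), c l • f l)) :
    m ≤ lam k := by
  obtain ⟨c, hc, horth⟩ := exists_combination_orthogonal f ψ k
  have h1 := (hm c).trans (h.inner_apply_le (h.nonneg k) fun i hi => horth i (by
    by_contra! hki
    exact (h.antitone hki).not_gt hi))
  exact le_of_mul_le_mul_right h1 (pow_pos (norm_pos_iff.2 (hf c hc)) 2)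

/-- Upper half of the min-max principle: if the form of `T` is at most `m ≥ 0` on the orthogonal
complement of `k` vectors, then `lam k ≤ m`. -/
theorem IsEigenDecomposition.le_of_forall_inner_le (h : IsEigenDecomposition T lam ψ)
    (φ : ℕ → E) {k : ℕ} {m : ℝ} (hm0 : 0 ≤ m)
    (hm : ∀ x : E, (∀ i < k, inner ℝ (φ i) x = (0 : ℝ)) → inner ℝ (T x) x ≤ m * ‖x‖ ^ 2) :
    lam k ≤ m := by
  -- If `lam k = 0`, the vectors `ψ l` need not be orthonormal, but `0 ≤ m` settles the claim.
  rcases (h.nonneg k).eq_or_lt with h0 | hpos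
  · rwa [← h0]
  have hle : ∀ l ∈ Finset.range (k + 1), lam k ≤ lam l := fun l hl =>
    h.antitone (Nat.lt_succ_iff.1 (Finset.mem_range.1 hl))
  have hne : ∀ l ∈ Finset.range (k + 1), lam l ≠ 0 := fun l hl => (hpos.trans_le (hle l hl)).ne'
  obtain ⟨c, ⟨l, hl, hcl⟩, horth⟩ := exists_combination_orthogonal ψ φ k
  refine le_of_mul_le_mul_right ((h.le_inner_apply_sum hne hle c).trans (hm _ horth)) ?_
  rw [h.norm_sq_sum hne]
  exact Finset.sum_pos' (fun _ _ => sq_nonneg _) ⟨l, hl, by positivity⟩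

end MinMax

/-! ### Second-order perturbation of a quadratic form -/

section Perturbation

variable {E : Type*} [NormedAddCommGroup E] [InnerProductSpace ℝ E]

/-- If `v` lies in the eigenspace of `H` for `θ`, and `u ⟂ v` lies where `H` exceeds `θ` by `γ`, the
first-order coupling `⟨D u, v⟩` costs only `2 ‖D‖² / γ`: completing the square absorbs it in the
surplus `γ ‖u‖²`. -/
theorem le_inner_add_apply_add {H D : E →L[ℝ] E} {u v : E} {θ γ μ : ℝ}
    (hsym : inner ℝ (H u) v = inner ℝ u (H v)) (hv : H v = θ • v) (huv : inner ℝ u v = (0 : ℝ))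
    (hu : (θ + γ) * ‖u‖ ^ 2 ≤ inner ℝ (H u) u) (hD : μ * ‖v‖ ^ 2 ≤ inner ℝ (D v) v)
    (hμ : μ ≤ ‖D‖) (hγ : 0 < γ) (hclose : 4 * ‖D‖ ≤ γ) :
    (θ + μ - 2 * ‖D‖ ^ 2 / γ) * ‖u + v‖ ^ 2 ≤ inner ℝ ((H + D) (u + v)) (u + v) := by
  have hD' : ∀ a b : E, -(‖D‖ * ‖a‖ * ‖b‖) ≤ inner ℝ (D a) b := fun a b =>
    (abs_le.1 ((abs_real_inner_le_norm _ _).trans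
      (mul_le_mul_of_nonneg_right (D.le_opNorm a) (norm_nonneg b)))).1
  have h1 : inner ℝ ((H + D) (u + v)) (u + v) = inner ℝ (H u) u + θ * ‖v‖ ^ 2
      + (inner ℝ (D u) u + inner ℝ (D u) v + inner ℝ (D v) u + inner ℝ (D v) v) := by
    have h2 : inner ℝ (H u) v = (0 : ℝ) := by rw [hsym, hv, inner_smul_right, huv, mul_zero]
    have h3 : inner ℝ (H v) u = (0 : ℝ) := by
      rw [hv, real_inner_smul_left, real_inner_comm, huv, mul_zero]
    have h4 : inner ℝ (H v) v = θ * ‖v‖ ^ 2 := by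
      rw [hv, real_inner_smul_left, real_inner_self_eq_norm_sq]
    simp only [add_apply, map_add, inner_add_left, inner_add_right]
    rw [h2, h3, h4]; ring
  have h5 : ‖u + v‖ ^ 2 = ‖u‖ ^ 2 + ‖v‖ ^ 2 := by
    rw [norm_add_sq_real, huv]; ring
  rw [h1, h5]
  have a1 := hD' u u
  have a2 := hD' u v
  have a3 := hD' v u
  obtain ⟨r, hr⟩ : ∃ r, r = ‖D‖ / γ := ⟨_, rfl⟩
  have hδ : ‖D‖ = r * γ := by rw [hr]; field_simp
  have hr0 : 2 * ‖D‖ ^ 2 / γ = 2 * r ^ 2 * γ := by rw [hδ]; field_simp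
  have hsq : 0 ≤ γ / 2 * (‖u‖ - 2 * r * ‖v‖) ^ 2 := by positivity
  have hsurplus : 0 ≤ (γ / 2 - ‖D‖ - μ) * ‖u‖ ^ 2 :=
    mul_nonneg (by linarith) (sq_nonneg _)
  have hpos : 0 ≤ 2 * r ^ 2 * γ * ‖u‖ ^ 2 := by positivity
  rw [hr0]
  rw [hδ] at a1 a2 a3 hsurplus
  nlinarith [a1, a2, a3, hsq, hsurplus, hpos]

/-- The upper counterpart of `le_inner_add_apply_add`, for `u` where `H` is below `θ` by `γ`. -/
theorem inner_add_apply_add_le {H D : E →L[ℝ] E} {u v : E} {θ γ μ : ℝ}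
    (hsym : inner ℝ (H u) v = inner ℝ u (H v)) (hv : H v = θ • v) (huv : inner ℝ u v = (0 : ℝ))
    (hu : inner ℝ (H u) u ≤ (θ - γ) * ‖u‖ ^ 2) (hD : inner ℝ (D v) v ≤ μ * ‖v‖ ^ 2)
    (hμ : -‖D‖ ≤ μ) (hγ : 0 < γ) (hclose : 4 * ‖D‖ ≤ γ) :
    inner ℝ ((H + D) (u + v)) (u + v) ≤ (θ + μ + 2 * ‖D‖ ^ 2 / γ) * ‖u + v‖ ^ 2 := by
  have h := le_inner_add_apply_add (H := -H) (D := -D) (u := u) (v := v) (θ := -θ) (γ := γ)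
    (μ := -μ) (by simp [hsym]) (by simp [hv]) huv
    (by rw [neg_apply, inner_neg_left]; linarith)
    (by rw [neg_apply, inner_neg_left]; linarith)
    (by rw [norm_neg]; linarith) hγ (by rwa [norm_neg])
  rw [show -H + -D = -(H + D) by abel, neg_apply, inner_neg_left, norm_neg] at h
  linarith

end Perturbation
/-! ### Eigenvalues near an isolated eigenvalue -/

/-- An isolated value of a non-negative decreasing sequence is at least its distance to the other
values: the first index beyond the block carries a non-negative value below `θ`. -/
theorem gap_le_of_antitone {lam : ℕ → ℝ} (hanti : Antitone lam) (hnonneg : ∀ k, 0 ≤ lam k)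
    {B : Finset ℕ} {θ γ : ℝ} {k : ℕ} (hk : k ∈ B) (hkθ : lam k = θ)
    (hgap : ∀ l ∉ B, γ ≤ |θ - lam l|) : γ ≤ θ := by
  have hn : B.sup id + 1 ∉ B := fun hmem => by
    have : B.sup id + 1 ≤ B.sup id := Finset.le_sup (f := id) hmem
    omega
  have hle : lam (B.sup id + 1) ≤ θ :=
    (hanti ((Finset.le_sup (f := id) hk).trans (Nat.le_succ _))).trans_eq hkθ
  have h1 := hgap _ hn
  rw [abs_of_nonneg (sub_nonneg.2 hle)] at h1
  linarith [hnonneg (B.sup id + 1)]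

section DiagonalBlock

variable {E : Type*} [NormedAddCommGroup E] [InnerProductSpace ℝ E]

theorem inner_apply_sum_of_diagonal {D : E →L[ℝ] E} {ψ : ℕ → E} {μ : ℕ → ℝ} {s : Finset ℕ}
    (hdiag : ∀ k ∈ s, ∀ l ∈ s, inner ℝ (D (ψ k)) (ψ l) = if k = l then μ k else 0) (c : ℕ → ℝ) :
    inner ℝ (D (∑ k ∈ s, c k • ψ k)) (∑ k ∈ s, c k • ψ k) = ∑ k ∈ s, μ k * c k ^ 2 := by
  rw [map_sum, sum_inner]
  refine Finset.sum_congr rfl fun k hk => ?_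
  rw [inner_sum, Finset.sum_congr rfl fun l hl => by
    rw [map_smul, real_inner_smul_left, inner_smul_right, hdiag k hk l hl]]
  simp only [mul_ite, mul_zero, Finset.sum_ite_eq, hk, if_true]
  ring

/-- Second-order eigenvalue expansion around an isolated eigenvalue `θ`, when the eigenvectors in
its eigenspace are chosen so that they diagonalize the compressed perturbation, with decreasing
diagonal entries `μ`.  The lower bound tests the form on the span of `ψ 0, …, ψ k`, the upper bound
on the orthogonal complement of `ψ 0, …, ψ (k - 1)`. -/
theorem abs_sub_sub_le_of_diagonal {H Hhat : E →L[ℝ] E} {lam lamhat : ℕ → ℝ} {ψ ψhat : ℕ → E}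
    (hdec : IsEigenDecomposition H lam ψ) (hdechat : IsEigenDecomposition Hhat lamhat ψhat)
    (hsym : (H : E →ₗ[ℝ] E).IsSymmetric) {B : Finset ℕ} {θ γ : ℝ} {μ : ℕ → ℝ}
    (hB : ∀ k ∈ B, lam k = θ) (hgap : ∀ l ∉ B, γ ≤ |θ - lam l|) (hγ : 0 < γ)
    (hclose : 4 * ‖Hhat - H‖ ≤ γ) (hμ : AntitoneOn μ B)
    (hdiag : ∀ k ∈ B, ∀ l ∈ B, inner ℝ ((Hhat - H) (ψ k)) (ψ l) = if k = l then μ k else 0)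
    {k : ℕ} (hk : k ∈ B) :
    |lamhat k - θ - μ k| ≤ 2 * ‖Hhat - H‖ ^ 2 / γ := by
  obtain ⟨D, hD⟩ : ∃ D, D = Hhat - H := ⟨_, rfl⟩
  have hHhat : Hhat = H + D := by rw [hD]; abel
  rw [← hD] at hclose hdiag ⊢
  have hbelow : ∀ l ∉ B, lam l ≤ θ → lam l ≤ θ - γ := fun l hl hle => by
    have := hgap l hl
    rw [abs_of_nonneg (by linarith)] at this
    linarith
  have habove : ∀ l ∉ B, θ ≤ lam l → θ + γ ≤ lam l := fun l hl hle => by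
    have := hgap l hl
    rw [abs_of_nonpos (by linarith)] at this
    linarith
  have hθγ : γ ≤ θ := gap_le_of_antitone hdec.antitone hdec.nonneg hk (hB k hk) hgap
  have hθ : 0 < θ := hγ.trans_le hθγ
  have hBne : ∀ l ∈ B, lam l ≠ 0 := fun l hl => by rw [hB l hl]; exact hθ.ne'
  have hμabs : |μ k| ≤ ‖D‖ := by
    have h1 : ‖ψ k‖ = 1 := hdec.orthonormal.1 ⟨k, hBne k hk⟩
    have h2 := (abs_real_inner_le_norm (D (ψ k)) (ψ k)).trans
      (mul_le_mul_of_nonneg_right (D.le_opNorm (ψ k)) (norm_nonneg _))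
    rwa [hdiag k hk k hk, if_pos rfl, h1, mul_one, mul_one] at h2
  have heig : ∀ s ⊆ B, ∀ c : ℕ → ℝ, H (∑ l ∈ s, c l • ψ l) = θ • ∑ l ∈ s, c l • ψ l := by
    intro s hs c
    rw [hdec.apply_sum (fun l hl => hBne l (hs hl)), Finset.smul_sum]
    refine Finset.sum_congr rfl fun l hl => ?_
    rw [hB l (hs hl), smul_smul]
  have hdiag' : ∀ s ⊆ B, ∀ a ∈ s, ∀ l ∈ s,
      inner ℝ (D (ψ a)) (ψ l) = if a = l then μ a else 0 :=
    fun s hs a ha l hl => hdiag a (hs ha) l (hs hl)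
  have hlower : θ + μ k - 2 * ‖D‖ ^ 2 / γ ≤ lamhat k := by
    have hle : ∀ l ∈ Finset.range (k + 1), θ ≤ lam l := fun l hl =>
      (hB k hk).ge.trans (hdec.antitone (Nat.lt_succ_iff.1 (Finset.mem_range.1 hl)))
    have hne : ∀ l ∈ Finset.range (k + 1), lam l ≠ 0 := fun l hl => (hθ.trans_le (hle l hl)).ne'
    refine hdechat.le_of_forall_le_inner (f := ψ) ?_ ?_
    · rintro c ⟨l, hl, hcl⟩ h0
      have h1 := hdec.norm_sq_sum hne c
      rw [h0, norm_zero] at h1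
      have h2 : 0 < ∑ l ∈ Finset.range (k + 1), c l ^ 2 :=
        Finset.sum_pos' (fun _ _ => sq_nonneg _) ⟨l, hl, by positivity⟩
      linarith
    -- The part of the span outside the block has eigenvalues at least `θ + γ`.
    · intro c
      rw [← Finset.sum_filter_add_sum_filter_not _ (fun l => l ∉ B), hHhat]
      simp only [not_not]
      have hsB : (Finset.range (k + 1)).filter (fun l => l ∈ B) ⊆ B := fun l hl =>
        (Finset.mem_filter.1 hl).2
      refine le_inner_add_apply_add (hsym _ _) (heig _ hsB c) ?_ ?_ ?_ (abs_le.1 hμabs).2 hγ hclose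
      · rw [hdec.inner_sum_sum (fun l hl => hne l (Finset.mem_filter.1 hl).1)
          (fun l hl => hne l (Finset.mem_filter.1 hl).1)]
        refine Finset.sum_eq_zero fun l hl => ?_
        simp only [Finset.mem_inter, Finset.mem_filter] at hl
        exact absurd hl.2.2 hl.1.2
      · exact hdec.le_inner_apply_sum (fun l hl => hne l (Finset.mem_filter.1 hl).1)
          (fun l hl => habove l (Finset.mem_filter.1 hl).2 (hle l (Finset.mem_filter.1 hl).1)) c
      · rw [inner_apply_sum_of_diagonal (hdiag' _ hsB),
          hdec.norm_sq_sum (fun l hl => hBne l (hsB hl)), Finset.mul_sum]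
        refine Finset.sum_le_sum fun l hl => mul_le_mul_of_nonneg_right ?_ (sq_nonneg _)
        exact hμ (hsB hl) hk (Nat.lt_succ_iff.1 (Finset.mem_range.1 (Finset.mem_filter.1 hl).1))
  have hupper : lamhat k ≤ θ + μ k + 2 * ‖D‖ ^ 2 / γ := by
    have hm0 : 0 ≤ θ + μ k + 2 * ‖D‖ ^ 2 / γ := by
      have : 0 ≤ 2 * ‖D‖ ^ 2 / γ := by positivity
      linarith [(abs_le.1 hμabs).1, norm_nonneg D]
    refine hdechat.le_of_forall_inner_le ψ hm0 fun x hx => ?_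
    obtain ⟨s, hs⟩ : ∃ s, s = B.filter (fun l => k ≤ l) := ⟨_, rfl⟩
    have hsB : s ⊆ B := by rw [hs]; exact Finset.filter_subset _ _
    have hsne : ∀ l ∈ s, lam l ≠ 0 := fun l hl => hBne l (hsB hl)
    -- `v` is the component of `x` in the eigenspace of `θ`: the coefficients below `k` vanish.
    obtain ⟨v, hv⟩ : ∃ v, v = ∑ l ∈ s, (inner ℝ (ψ l) x : ℝ) • ψ l := ⟨_, rfl⟩
    have horth : ∀ l, θ - γ < lam l → inner ℝ (ψ l) (x - v) = (0 : ℝ) := by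
      intro l hl
      rw [inner_sub_right, hv, hdec.inner_eigenvector_sum hsne _ (by linarith : 0 < lam l).ne']
      split_ifs with hls
      · exact sub_self _
      · rw [sub_zero]
        refine hx l ?_
        by_contra! hkl
        refine hl.not_ge (hbelow l (fun hlB => hls ?_) ((hdec.antitone hkl).trans_eq (hB k hk)))
        rw [hs]
        exact Finset.mem_filter.2 ⟨hlB, hkl⟩
    have huv : inner ℝ (x - v) v = (0 : ℝ) := by
      nth_rw 2 [hv]
      rw [inner_sum]
      refine Finset.sum_eq_zero fun l hl => ?_
      rw [inner_smul_right, real_inner_comm (ψ l) (x - v),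
        horth l (by rw [hB l (hsB hl)]; linarith), mul_zero]
    have hmain := inner_add_apply_add_le (H := H) (D := D) (u := x - v) (v := v) (θ := θ) (γ := γ)
      (μ := μ k) (hsym _ _) (by rw [hv]; exact heig s hsB _) huv
      (hdec.inner_apply_le (by linarith) horth) (by
        rw [hv, inner_apply_sum_of_diagonal (hdiag' s hsB), hdec.norm_sq_sum hsne, Finset.mul_sum]
        refine Finset.sum_le_sum fun l hl => mul_le_mul_of_nonneg_right ?_ (sq_nonneg _)
        refine hμ hk (hsB hl) ?_
        rw [hs] at hl
        exact (Finset.mem_filter.1 hl).2) (abs_le.1 hμabs).1 hγ hclose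
    rwa [sub_add_cancel, ← hHhat] at hmain
  rw [abs_le]
  constructor <;> linarith

end DiagonalBlock

/-! ### Rotating the eigenvectors within a block -/

section Rotation

variable {E : Type*} [NormedAddCommGroup E] [InnerProductSpace ℝ E]

/-- The linear combination of the vectors `ψ k`, `k ∈ B`, with given coefficients, listed in
increasing order of `k`. -/
noncomputable def blockCombination (ψ : ℕ → E) (B : Finset ℕ)
    (w : EuclideanSpace ℝ (Fin B.card)) : E :=
  ∑ a, w a • ψ (B.orderEmbOfFin rfl a)

/-- The sequence `ψ` with the vectors `ψ k`, `k ∈ B`, replaced by their combinations along an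
orthonormal basis of the coefficient space. -/
noncomputable def rotateBlock (ψ : ℕ → E) (B : Finset ℕ)
    (b : OrthonormalBasis (Fin B.card) ℝ (EuclideanSpace ℝ (Fin B.card))) (k : ℕ) : E :=
  if h : k ∈ B then blockCombination ψ B (b ((B.orderIsoOfFin rfl).symm ⟨k, h⟩)) else ψ k

theorem exists_orderEmbOfFin_eq {B : Finset ℕ} {k : ℕ} (hk : k ∈ B) :
    ∃ a, B.orderEmbOfFin rfl a = k := by
  have : k ∈ Set.range (B.orderEmbOfFin rfl) := by rwa [Finset.range_orderEmbOfFin]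
  exact this

theorem orderIsoOfFin_symm_orderEmbOfFin (B : Finset ℕ) (a : Fin B.card)
    (h : B.orderEmbOfFin rfl a ∈ B) :
    (B.orderIsoOfFin rfl).symm ⟨B.orderEmbOfFin rfl a, h⟩ = a := by
  rw [OrderIso.symm_apply_eq]
  exact Subtype.ext (Finset.coe_orderIsoOfFin_apply B rfl a).symm

theorem rotateBlock_of_notMem (ψ : ℕ → E) {B : Finset ℕ}
    (b : OrthonormalBasis (Fin B.card) ℝ (EuclideanSpace ℝ (Fin B.card))) {k : ℕ} (hk : k ∉ B) :
    rotateBlock ψ B b k = ψ k :=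
  dif_neg hk

theorem rotateBlock_orderEmbOfFin (ψ : ℕ → E) (B : Finset ℕ)
    (b : OrthonormalBasis (Fin B.card) ℝ (EuclideanSpace ℝ (Fin B.card))) (a : Fin B.card) :
    rotateBlock ψ B b (B.orderEmbOfFin rfl a) = blockCombination ψ B (b a) := by
  rw [rotateBlock, dif_pos (B.orderEmbOfFin_mem rfl a), orderIsoOfFin_symm_orderEmbOfFin]

theorem sum_orderEmbOfFin {M : Type*} [AddCommMonoid M] (B : Finset ℕ) (g : ℕ → M) :
    ∑ a : Fin B.card, g (B.orderEmbOfFin rfl a) = ∑ k ∈ B, g k := by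
  rw [← Finset.sum_coe_sort B g, ← (B.orderIsoOfFin rfl).toEquiv.sum_comp]
  simp

theorem inner_blockCombination_left (ψ : ℕ → E) (B : Finset ℕ)
    (w : EuclideanSpace ℝ (Fin B.card)) (x : E) :
    inner ℝ (blockCombination ψ B w) x
      = inner ℝ w (WithLp.toLp 2 fun a => (inner ℝ (ψ (B.orderEmbOfFin rfl a)) x : ℝ)) := by
  rw [blockCombination, sum_inner, PiLp.inner_apply]
  refine Finset.sum_congr rfl fun a _ => ?_
  rw [real_inner_smul_left]
  simp [mul_comm]

theorem inner_apply_blockCombination (D : E →L[ℝ] E) (ψ : ℕ → E) (B : Finset ℕ)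
    (w w' : EuclideanSpace ℝ (Fin B.card)) :
    inner ℝ (D (blockCombination ψ B w)) (blockCombination ψ B w')
      = ∑ a, w a * (gramMatrix D ψ B).mulVec w' a := by
  rw [blockCombination, map_sum, sum_inner]
  refine Finset.sum_congr rfl fun a _ => ?_
  rw [map_smul, real_inner_smul_left, blockCombination, inner_sum]
  simp only [Matrix.mulVec, dotProduct, gramMatrix, Matrix.of_apply, inner_smul_right]
  congr 1
  exact Finset.sum_congr rfl fun c _ => mul_comm _ _

/-- The block sum in the eigen-decomposition does not depend on the orthonormal basis. -/
theorem sum_rotateBlock (ψ : ℕ → E) (B : Finset ℕ)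
    (b : OrthonormalBasis (Fin B.card) ℝ (EuclideanSpace ℝ (Fin B.card))) (x : E) :
    ∑ k ∈ B, (inner ℝ (rotateBlock ψ B b k) x : ℝ) • rotateBlock ψ B b k
      = ∑ k ∈ B, (inner ℝ (ψ k) x : ℝ) • ψ k := by
  obtain ⟨y, hy⟩ : ∃ y : EuclideanSpace ℝ (Fin B.card),
    y = WithLp.toLp 2 fun a => (inner ℝ (ψ (B.orderEmbOfFin rfl a)) x : ℝ) := ⟨_, rfl⟩
  rw [← sum_orderEmbOfFin B, ← sum_orderEmbOfFin B (fun k => (inner ℝ (ψ k) x : ℝ) • ψ k)]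
  simp only [rotateBlock_orderEmbOfFin, inner_blockCombination_left, ← hy]
  have h1 : ∀ a, y a = (inner ℝ (ψ (B.orderEmbOfFin rfl a)) x : ℝ) := fun a => by rw [hy]
  simp only [← h1]
  simp only [blockCombination, Finset.smul_sum]
  rw [Finset.sum_comm]
  refine Finset.sum_congr rfl fun c _ => ?_
  simp only [smul_smul, ← Finset.sum_smul]
  congr 1
  have h2 := congrArg (fun z : EuclideanSpace ℝ (Fin B.card) => z c) (b.sum_repr' y)
  simpa using h2

/-- Rotating the eigenvectors within the eigenspace of a nonzero eigenvalue leaves an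
eigen-decomposition of the same operator. -/
theorem IsEigenDecomposition.rotateBlock {T : E →L[ℝ] E} {lam : ℕ → ℝ} {ψ : ℕ → E}
    (h : IsEigenDecomposition T lam ψ) {B : Finset ℕ} {θ : ℝ} (hB : ∀ k ∈ B, lam k = θ)
    (hθ : θ ≠ 0) (b : OrthonormalBasis (Fin B.card) ℝ (EuclideanSpace ℝ (Fin B.card))) :
    IsEigenDecomposition T lam (rotateBlock ψ B b) where
  antitone := h.antitone
  nonneg := h.nonneg
  orthonormal := by
    have hne : ∀ a, lam (B.orderEmbOfFin rfl a) ≠ 0 := fun a => by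
      rwa [hB _ (B.orderEmbOfFin_mem rfl a)]
    have hout : ∀ a l, l ∉ B → lam l ≠ 0 →
        inner ℝ (blockCombination ψ B (b a)) (ψ l) = (0 : ℝ) := by
      intro a l hl hl0
      rw [inner_blockCombination_left, PiLp.inner_apply]
      refine Finset.sum_eq_zero fun c _ => ?_
      have : B.orderEmbOfFin rfl c ≠ l := fun hc => hl (hc ▸ B.orderEmbOfFin_mem rfl c)
      simp [h.inner_eq (hne c) hl0, this]
    have hin : ∀ a c, inner ℝ (blockCombination ψ B (b a)) (blockCombination ψ B (b c))
        = if a = c then (1 : ℝ) else 0 := by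
      intro a c
      rw [inner_blockCombination_left, ← orthonormal_iff_ite.1 b.orthonormal a c]
      congr 1
      ext d
      simp [blockCombination, inner_sum, inner_smul_right, h.inner_eq (hne _) (hne _)]
    rw [orthonormal_iff_ite]
    rintro ⟨k, hk⟩ ⟨l, hl⟩
    simp only [Subtype.mk.injEq]
    by_cases hkB : k ∈ B <;> by_cases hlB : l ∈ B
    · obtain ⟨a, rfl⟩ := exists_orderEmbOfFin_eq hkB
      obtain ⟨c, rfl⟩ := exists_orderEmbOfFin_eq hlB
      simp [rotateBlock_orderEmbOfFin, hin]
    · obtain ⟨a, rfl⟩ := exists_orderEmbOfFin_eq hkB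
      rw [rotateBlock_orderEmbOfFin, rotateBlock_of_notMem ψ b hlB, hout a l hlB hl,
        if_neg (ne_of_mem_of_not_mem hkB hlB)]
    · obtain ⟨c, rfl⟩ := exists_orderEmbOfFin_eq hlB
      rw [rotateBlock_orderEmbOfFin, rotateBlock_of_notMem ψ b hkB, real_inner_comm,
        hout c k hkB hk, if_neg (ne_of_mem_of_not_mem hlB hkB).symm]
    · rw [rotateBlock_of_notMem ψ b hkB, rotateBlock_of_notMem ψ b hlB, h.inner_eq hk hl]
  hasSum x := by
    -- The two series differ only in the block, and the block sums agree.
    have h1 : HasSum (fun k => lam k • ((inner ℝ (SpectralExpansion.rotateBlock ψ B b k) x : ℝ) •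
        SpectralExpansion.rotateBlock ψ B b k) - lam k • ((inner ℝ (ψ k) x : ℝ) • ψ k)) 0 := by
      have h2 := hasSum_sum_of_ne_finset_zero (L := .unconditional ℕ) (f := fun k =>
        lam k • ((inner ℝ (SpectralExpansion.rotateBlock ψ B b k) x : ℝ) •
        SpectralExpansion.rotateBlock ψ B b k) - lam k • ((inner ℝ (ψ k) x : ℝ) • ψ k)) (s := B)
        (fun k hk => by rw [rotateBlock_of_notMem ψ b hk, sub_self])
      convert h2 using 1
      rw [Finset.sum_congr rfl fun k hk => by rw [hB k hk], Finset.sum_sub_distrib,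
        ← Finset.smul_sum, ← Finset.smul_sum, sum_rotateBlock, sub_self]
    simpa using h1.add (h.hasSum x)

end Rotation
/-! ### Eigenvalue expansion in a single block -/

section BlockExpansion

variable {E : Type*} [NormedAddCommGroup E] [InnerProductSpace ℝ E] [CompleteSpace E]

theorem specDown_antitone {m : ℕ} {A : Matrix (Fin m) (Fin m) ℝ} (hA : A.IsHermitian) :
    Antitone (specDown A hA) := fun _ _ hij => hA.eigenvalues₀_antitone hij

/-- An orthonormal eigenbasis listed in the order of `specDown`. -/
theorem exists_orthonormalBasis_mulVec_eq_specDown {m : ℕ} {A : Matrix (Fin m) (Fin m) ℝ}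
    (hA : A.IsHermitian) : ∃ b : OrthonormalBasis (Fin m) ℝ (EuclideanSpace ℝ (Fin m)),
      ∀ a, A.mulVec (b a) = specDown A hA a • (b a : Fin m → ℝ) := by
  let e : Fin m ≃ Fin m := (finCongr (Fintype.card_fin m).symm).trans
    (Fintype.equivOfCardEq (Fintype.card_fin _))
  refine ⟨hA.eigenvectorBasis.reindex e.symm, fun a => ?_⟩
  have h1 : hA.eigenvalues (e a) = specDown A hA a := by
    simp [specDown, Matrix.IsHermitian.eigenvalues, e]
  rw [OrthonormalBasis.reindex_apply, Equiv.symm_symm, hA.mulVec_eigenvectorBasis, h1]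

/-- Second-order eigenvalue expansion around an isolated eigenvalue, for arbitrary eigenvectors:
rotating them along an eigenbasis of the Gram matrix reduces it to the diagonal case. -/
theorem abs_sub_sub_specDown_le {H Hhat : E →L[ℝ] E} {lam lamhat : ℕ → ℝ} {ψ ψhat : ℕ → E}
    (hdec : IsEigenDecomposition H lam ψ) (hdechat : IsEigenDecomposition Hhat lamhat ψhat)
    (hH : IsSelfAdjoint H) {B : Finset ℕ} {θ γ : ℝ} (hθ : θ ≠ 0)
    (hB : ∀ k ∈ B, lam k = θ) (hgap : ∀ l ∉ B, γ ≤ |θ - lam l|) (hγ : 0 < γ)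
    (hclose : 4 * ‖Hhat - H‖ ≤ γ) (hG : (gramMatrix (Hhat - H) ψ B).IsHermitian)
    (a : Fin B.card) :
    |lamhat (B.orderEmbOfFin rfl a) - θ - specDown (gramMatrix (Hhat - H) ψ B) hG a|
      ≤ 2 * ‖Hhat - H‖ ^ 2 / γ := by
  obtain ⟨b, hb⟩ := exists_orthonormalBasis_mulVec_eq_specDown hG
  obtain ⟨μ, hμ⟩ : ∃ μ : ℕ → ℝ, ∀ c, μ (B.orderEmbOfFin rfl c)
      = specDown (gramMatrix (Hhat - H) ψ B) hG c :=
    ⟨fun k => if h : k ∈ B then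
      specDown (gramMatrix (Hhat - H) ψ B) hG ((B.orderIsoOfFin rfl).symm ⟨k, h⟩) else 0,
      fun c => (dif_pos (B.orderEmbOfFin_mem rfl c)).trans
        (by rw [orderIsoOfFin_symm_orderEmbOfFin])⟩
  rw [← hμ]
  refine abs_sub_sub_le_of_diagonal (hdec.rotateBlock hB hθ b) hdechat hH.isSymmetric hB hgap hγ
    hclose ?_ ?_ (B.orderEmbOfFin_mem rfl a)
  · intro k hk l hl hkl
    obtain ⟨c, rfl⟩ := exists_orderEmbOfFin_eq (Finset.mem_coe.1 hk)
    obtain ⟨d, rfl⟩ := exists_orderEmbOfFin_eq (Finset.mem_coe.1 hl)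
    rw [hμ, hμ]
    exact specDown_antitone hG ((B.orderEmbOfFin rfl).le_iff_le.1 hkl)
  · intro k hk l hl
    obtain ⟨c, rfl⟩ := exists_orderEmbOfFin_eq hk
    obtain ⟨d, rfl⟩ := exists_orderEmbOfFin_eq hl
    rw [rotateBlock_orderEmbOfFin, rotateBlock_orderEmbOfFin, inner_apply_blockCombination, hb, hμ]
    have h1 := orthonormal_iff_ite.1 b.orthonormal c d
    rw [PiLp.inner_apply] at h1
    simp only [RCLike.inner_apply, conj_trivial] at h1
    simp only [Pi.smul_apply, smul_eq_mul, EmbeddingLike.apply_eq_iff_eq]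
    rw [show ∑ x, (b c) x * (specDown _ hG d * (b d) x)
        = specDown _ hG d * ∑ x, (b d) x * (b c) x by
      rw [Finset.mul_sum]; exact Finset.sum_congr rfl fun _ _ => by ring, h1]
    split_ifs with hcd
    · rw [hcd, mul_one]
    · rw [mul_zero]

end BlockExpansion

/-! ### The blocks of an index set -/

section Blocks

theorem mem_block {lam : ℕ → ℝ} {J : Finset ℕ} {j : Fin (numDistinct lam J)} {k : ℕ} :
    k ∈ block lam J j ↔ k ∈ J ∧ lam k = theta lam J j := Finset.mem_filter

theorem theta_strictAnti (lam : ℕ → ℝ) (J : Finset ℕ) : StrictAnti (theta lam J) := fun _ _ h =>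
  ((J.image lam).orderEmbOfFin rfl).strictMono (Fin.rev_lt_rev.2 h)

theorem exists_mem_block (lam : ℕ → ℝ) (J : Finset ℕ) (j : Fin (numDistinct lam J)) :
    ∃ k, k ∈ block lam J j := by
  have h := (J.image lam).orderEmbOfFin_mem rfl (Fin.rev j)
  obtain ⟨k, hk, hkl⟩ := Finset.mem_image.1 h
  exact ⟨k, mem_block.2 ⟨hk, hkl⟩⟩

theorem blockGap_le (lam : ℕ → ℝ) (J : Finset ℕ) (j : Fin (numDistinct lam J)) {l : ℕ}
    (hl : l ∉ block lam J j) : blockGap lam J j ≤ |theta lam J j - lam l| :=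
  csInf_le ⟨0, by rintro _ ⟨l, _, rfl⟩; exact abs_nonneg _⟩ ⟨l, hl, rfl⟩

/-- A positive gap around `J` makes every individual gap positive: the other values on `J` are
finitely many. -/
theorem blockGap_pos {lam : ℕ → ℝ} {J : Finset ℕ} (hgap : 0 < spectralGap lam J)
    (j : Fin (numDistinct lam J)) : 0 < blockGap lam J j := by
  obtain ⟨k, hk⟩ := exists_mem_block lam J j
  obtain ⟨hkJ, hkθ⟩ := mem_block.1 hk
  obtain ⟨r, hr0, hr⟩ : ∃ r > 0, ∀ l ∈ J, lam l ≠ theta lam J j → r ≤ |theta lam J j - lam l| := by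
    rcases (J.filter fun l => lam l ≠ theta lam J j).eq_empty_or_nonempty with he | hne
    · refine ⟨1, one_pos, fun l hl hne => ?_⟩
      exact absurd hne (Finset.filter_eq_empty_iff.1 he hl)
    · obtain ⟨l, hl, hmin⟩ := Finset.exists_min_image _ (fun l => |theta lam J j - lam l|) hne
      exact ⟨_, abs_pos.2 (sub_ne_zero.2 (Finset.mem_filter.1 hl).2.symm),
        fun i hi hine => hmin i (Finset.mem_filter.2 ⟨hi, hine⟩)⟩
  obtain ⟨n, hn⟩ := Infinite.exists_notMem_finset (block lam J j)
  refine (lt_min hr0 hgap).trans_le (le_csInf ⟨_, n, hn, rfl⟩ ?_)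
  rintro _ ⟨l, hl, rfl⟩
  by_cases hlJ : l ∈ J
  · exact (min_le_left _ _).trans (hr l hlJ fun h => hl (mem_block.2 ⟨hlJ, h⟩))
  · refine (min_le_right _ _).trans (csInf_le ⟨0, ?_⟩ ⟨k, hkJ, l, hlJ, by rw [hkθ]⟩)
    rintro _ ⟨_, _, _, _, rfl⟩
    exact abs_nonneg _

theorem theta_pos {lam : ℕ → ℝ} {J : Finset ℕ} (hanti : Antitone lam) (hnonneg : ∀ k, 0 ≤ lam k)
    (hgap : 0 < spectralGap lam J) (j : Fin (numDistinct lam J)) : 0 < theta lam J j := by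
  obtain ⟨k, hk⟩ := exists_mem_block lam J j
  exact (blockGap_pos hgap j).trans_le
    (gap_le_of_antitone hanti hnonneg hk (mem_block.1 hk).2 fun l hl => blockGap_le lam J j hl)

/-- `finSigmaFinEquiv` enumerates the pairs lexicographically. -/
theorem finSigmaFinEquiv_symm_lt {K : ℕ} {n : Fin K → ℕ} {x y : Fin (∑ j, n j)} (h : x < y) :
    (finSigmaFinEquiv.symm x).1 < (finSigmaFinEquiv.symm y).1 ∨
      ∃ (j : Fin K) (a b : Fin (n j)), finSigmaFinEquiv.symm x = ⟨j, a⟩ ∧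
        finSigmaFinEquiv.symm y = ⟨j, b⟩ ∧ a < b := by
  obtain ⟨p, rfl⟩ := finSigmaFinEquiv.surjective x
  obtain ⟨q, rfl⟩ := finSigmaFinEquiv.surjective y
  simp only [Equiv.symm_apply_apply]
  rw [Fin.lt_def, finSigmaFinEquiv_apply, finSigmaFinEquiv_apply] at h
  obtain ⟨j, a⟩ := p
  obtain ⟨i, b⟩ := q
  rcases lt_trichotomy j i with hji | rfl | hij
  · exact Or.inl hji
  · refine Or.inr ⟨j, a, b, rfl, rfl, ?_⟩
    simpa using h
  · exfalso
    have hsum : ∀ m (hm : m ≤ K), ∑ t : Fin m, n (Fin.castLE hm t)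
        = ∑ t ∈ Finset.range m, if ht : t < K then n ⟨t, ht⟩ else 0 := fun m hm => by
      rw [Finset.sum_range]
      refine Finset.sum_congr rfl fun t _ => ?_
      rw [dif_pos (t.2.trans_le hm)]
      rfl
    dsimp only at h
    rw [hsum, hsum] at h
    have h1 := Finset.sum_le_sum_of_subset (f := fun t => if ht : t < K then n ⟨t, ht⟩ else 0)
      (Finset.range_subset_range.2 (Nat.succ_le_of_lt (Fin.lt_def.1 hij)))
    rw [Finset.sum_range_succ, dif_pos i.2] at h1
    have h2 := b.2
    simp only [Fin.eta] at h1
    omega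

/-- Concatenating the blocks in decreasing order of their eigenvalues lists `J` increasingly. -/
theorem orderEmbOfFin_eq_block {lam : ℕ → ℝ} (hanti : Antitone lam) (J : Finset ℕ)
    (x : Fin (∑ j, (block lam J j).card)) :
    J.orderEmbOfFin rfl (Fin.cast (card_eq_sum_card_block lam J).symm x)
      = (block lam J (finSigmaFinEquiv.symm x).1).orderEmbOfFin rfl
          (finSigmaFinEquiv.symm x).2 := by
  have hmono : StrictMono fun x : Fin (∑ j, (block lam J j).card) =>
      (block lam J (finSigmaFinEquiv.symm x).1).orderEmbOfFin rfl
        (finSigmaFinEquiv.symm x).2 := by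
    intro x y hxy
    rcases finSigmaFinEquiv_symm_lt hxy with h | ⟨j, a, b, hx, hy, hab⟩
    · have h1 := theta_strictAnti lam J h
      rw [← (mem_block.1 (Finset.orderEmbOfFin_mem _ rfl (finSigmaFinEquiv.symm x).2)).2,
        ← (mem_block.1 (Finset.orderEmbOfFin_mem _ rfl (finSigmaFinEquiv.symm y).2)).2] at h1
      exact hanti.reflect_lt h1
    · dsimp only
      rw [hx, hy]
      exact (Finset.orderEmbOfFin _ rfl).strictMono hab
  have h := Finset.orderEmbOfFin_unique (card_eq_sum_card_block lam J)
    (fun x => (mem_block.1 (Finset.orderEmbOfFin_mem _ rfl (finSigmaFinEquiv.symm x).2)).1) hmono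
  refine Eq.trans ?_ (congrFun h x).symm
  rw [Finset.orderEmbOfFin_eq_orderEmbOfFin_iff]
  rfl

theorem orderEmbOfFin_cast_finSigmaFinEquiv {lam : ℕ → ℝ} (hanti : Antitone lam) (J : Finset ℕ)
    (j : Fin (numDistinct lam J)) (a : Fin (block lam J j).card) :
    J.orderEmbOfFin rfl (Fin.cast (card_eq_sum_card_block lam J).symm (finSigmaFinEquiv ⟨j, a⟩))
      = (block lam J j).orderEmbOfFin rfl a := by
  rw [orderEmbOfFin_eq_block hanti, Equiv.symm_apply_apply]

theorem vecDirectSum_finSigmaFinEquiv {K : ℕ} {n : Fin K → ℕ} (v : (j : Fin K) → Fin (n j) → ℝ)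
    (j : Fin K) (a : Fin (n j)) : vecDirectSum v (finSigmaFinEquiv ⟨j, a⟩) = v j a := by
  rw [vecDirectSum, Equiv.symm_apply_apply]

end Blocks

end SpectralExpansion

theorem mainTheorem2 {E : Type*} [NormedAddCommGroup E] [InnerProductSpace ℝ E] [CompleteSpace E]
    [TopologicalSpace.SeparableSpace E]
    (H Hhat : E →L[ℝ] E)
    (hHc : IsCompactOperator H) (hHhatc : IsCompactOperator Hhat)
    (hH : IsSelfAdjoint H) (hHhat : IsSelfAdjoint Hhat)
    (lam lamhat : ℕ → ℝ) (ψ ψhat : ℕ → E)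
    (hdec : SpectralExpansion.IsEigenDecomposition H lam ψ)
    (hdechat : SpectralExpansion.IsEigenDecomposition Hhat lamhat ψhat)
    (J : Finset ℕ) (hgap : 0 < SpectralExpansion.spectralGap lam J)
    (hclose : ∀ j : Fin (SpectralExpansion.numDistinct lam J),
      ‖Hhat - H‖ / SpectralExpansion.blockGap lam J j < 1 / 4) :
    ‖WithLp.toLp 2 (fun i : Fin J.card =>
        SpectralExpansion.indexedVec (fun k => lamhat k - lam k) J i
          - SpectralExpansion.vecDirectSum
              (fun j : Fin (SpectralExpansion.numDistinct lam J) =>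
                SpectralExpansion.specDown
                  (SpectralExpansion.gramMatrix (Hhat - H) ψ (SpectralExpansion.block lam J j))
                  (SpectralExpansion.gramMatrix_isHermitian (hHhat.sub hH) ψ
                    (SpectralExpansion.block lam J j)))
              (Fin.cast (SpectralExpansion.card_eq_sum_card_block lam J) i))‖
      ≤ Real.sqrt (∑ j : Fin (SpectralExpansion.numDistinct lam J),
          ((SpectralExpansion.block lam J j).card : ℝ)
            * (11 * SpectralExpansion.blockGap lam J j + 32 * SpectralExpansion.theta lam J j) ^ 2
            / 4
            * (‖Hhat - H‖ / SpectralExpansion.blockGap lam J j) ^ 4) := by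
  open SpectralExpansion in
  have hentry : ∀ (j : Fin (numDistinct lam J)) (a : Fin (block lam J j).card),
      (lamhat ((block lam J j).orderEmbOfFin rfl a) - theta lam J j
        - specDown (gramMatrix (Hhat - H) ψ (block lam J j))
            (gramMatrix_isHermitian (hHhat.sub hH) ψ (block lam J j)) a) ^ 2
      ≤ (11 * blockGap lam J j + 32 * theta lam J j) ^ 2 / 4
          * (‖Hhat - H‖ / blockGap lam J j) ^ 4 := by
    intro j a
    have hγ := blockGap_pos hgap j
    have hθ := theta_pos hdec.antitone hdec.nonneg hgap j
    have hδ : 4 * ‖Hhat - H‖ ≤ blockGap lam J j := by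
      have := (div_lt_iff₀ hγ).1 (hclose j)
      linarith
    have h1 := abs_sub_sub_specDown_le hdec hdechat hH hθ.ne'
      (fun k hk => (mem_block.1 hk).2) (fun l hl => blockGap_le lam J j hl) hγ hδ
      (gramMatrix_isHermitian (hHhat.sub hH) ψ (block lam J j)) a
    -- The stated constant exceeds `2 ‖D‖² / γ`, since `2 γ ≤ (11 γ + 32 θ) / 2`.
    have h2 : 2 * ‖Hhat - H‖ ^ 2 / blockGap lam J j
        ≤ (11 * blockGap lam J j + 32 * theta lam J j) / 2
          * (‖Hhat - H‖ / blockGap lam J j) ^ 2 := by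
      rw [show 2 * ‖Hhat - H‖ ^ 2 / blockGap lam J j
        = 2 * blockGap lam J j * (‖Hhat - H‖ / blockGap lam J j) ^ 2 by field_simp]
      exact mul_le_mul_of_nonneg_right (by linarith) (sq_nonneg _)
    rw [← sq_abs]
    refine (pow_le_pow_left₀ (abs_nonneg _) (h1.trans h2) 2).trans_eq ?_
    ring
  rw [EuclideanSpace.norm_eq]
  refine Real.sqrt_le_sqrt ?_
  rw [← (finSigmaFinEquiv.trans
    (finCongr (SpectralExpansion.card_eq_sum_card_block lam J).symm)).sum_comp,
    Fintype.sum_sigma]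
  refine Finset.sum_le_sum fun j _ => ?_
  have hcard : ((SpectralExpansion.block lam J j).card : ℝ)
      * (11 * SpectralExpansion.blockGap lam J j + 32 * SpectralExpansion.theta lam J j) ^ 2 / 4
      * (‖Hhat - H‖ / SpectralExpansion.blockGap lam J j) ^ 4
      = ∑ _a : Fin (SpectralExpansion.block lam J j).card,
        (11 * SpectralExpansion.blockGap lam J j + 32 * SpectralExpansion.theta lam J j) ^ 2 / 4
          * (‖Hhat - H‖ / SpectralExpansion.blockGap lam J j) ^ 4 := by
    rw [Finset.sum_const, Finset.card_univ, Fintype.card_fin, nsmul_eq_mul]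
    ring
  rw [hcard]
  refine Finset.sum_le_sum fun a _ => ?_
  have hθ := (SpectralExpansion.mem_block.1
    ((SpectralExpansion.block lam J j).orderEmbOfFin_mem rfl a)).2
  rw [Real.norm_eq_abs, sq_abs]
  refine le_of_eq_of_le ?_ (hentry j a)
  rw [Equiv.trans_apply, finCongr_apply, PiLp.toLp_apply, SpectralExpansion.indexedVec,
    SpectralExpansion.orderEmbOfFin_cast_finSigmaFinEquiv hdec.antitone, hθ, Fin.cast_cast,
    Fin.cast_eq_self, SpectralExpansion.vecDirectSum_finSigmaFinEquiv]
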